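/- A \emph{radial weight} on $\mathbb C$ is a function $z\mapsto v(|z|)$, where $v:[0,\infty)\to(0,\infty)$ is continuous and increasing (not necessarily strictly) and $\log r=o(\log v(r))$ as $r\to\infty$. For a radial weight $v$ let $$H_v(\mathbb C)=\Big\{f:\mathbb C\to\mathbb C \text{ entire}:\ \|f\|_v:=\sup_{z\in\mathbb C}\frac{|f(z)|}{v(|z|)}<\infty\Big\},$$ normed by $\|\cdot\|_v$, and let $If(z)=\int_0^z f(\zeta)\,d\zeta$ be the integration operator. A radial weight $w$ is called a \emph{Clunie--Kővári weight} if $x\mapsto\log w(e^x)$ is convex on $\mathbb R$ and there is a nonnegative increasing function $\omega$ on $[1,\infty)$ with $$w(r)=w(1)\exp\int_1^r\frac{\omega(\rho)}{\rho}\,d\rho\quad(r\ge1)$$ and a constant $c>1$ such that $\omega(cr)-\omega(r)\ge1$ for all $r\ge1$. Let $w$ be a Clunie--Kővári weight and $v$ an arbitrary radial weight on $\mathbb C$. Then $I$ maps $H_w(\mathbb C)$ into $H_v(\mathbb C)$ and $I:H_w(\mathbb C)\to H_v(\mathbb C)$ is continuous (equivalently, bounded) if and only if $$\limsup_{r\to\infty}\frac1{v(r)}\int_0^r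 w(t)\,dt<\infty.$$ -/

import Mathlib

/-- A radial weight on `ℂ`, given by its radial profile `r ↦ v(r)` on `[0, ∞)`; the weight itself is
`z ↦ v(|z|)`. Values of `toFun` at negative reals play no role. -/
structure RadialWeight where
  /-- the radial profile -/
  toFun : ℝ → ℝ
  pos : ∀ r, 0 ≤ r → 0 < toFun r
  continuousOn : ContinuousOn toFun (Set.Ici 0)
  monotoneOn : MonotoneOn toFun (Set.Ici 0)
  log_isLittleO : (fun r => Real.log r) =o[Filter.atTop] (fun r => Real.log (toFun r))

namespace RadialWeight

instance : CoeFun RadialWeight (fun _ => ℝ → ℝ) := ⟨RadialWeight.toFun⟩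

theorem pos_norm (v : RadialWeight) (z : ℂ) : 0 < v ‖z‖ := v.pos _ (norm_nonneg z)

/-- The entire functions `f` with `sup_z |f(z)| / v(|z|) < ∞`, as a subspace of all functions. -/
def subspace (v : RadialWeight) : Submodule ℂ (ℂ → ℂ) where
  carrier := {f | Differentiable ℂ f ∧ BddAbove (Set.range fun z : ℂ => ‖f z‖ / v ‖z‖)}
  zero_mem' := ⟨differentiable_const 0, 0, by rintro _ ⟨z, rfl⟩; simp⟩
  add_mem' := by
    rintro f g ⟨hf, A, hA⟩ ⟨hg, B, hB⟩
    refine ⟨hf.add hg, A + B, ?_⟩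
    rintro _ ⟨z, rfl⟩
    have h1 : ‖f z‖ / v ‖z‖ ≤ A := hA ⟨z, rfl⟩
    have h2 : ‖g z‖ / v ‖z‖ ≤ B := hB ⟨z, rfl⟩
    have h3 : ‖(f + g) z‖ / v ‖z‖ ≤ (‖f z‖ + ‖g z‖) / v ‖z‖ :=
      div_le_div_of_nonneg_right (norm_add_le _ _) (v.pos_norm z).le
    rw [add_div] at h3
    exact h3.trans (add_le_add h1 h2)
  smul_mem' := by
    rintro a f ⟨hf, A, hA⟩
    refine ⟨hf.const_smul a, ‖a‖ * A, ?_⟩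
    rintro _ ⟨z, rfl⟩
    have h1 : ‖f z‖ / v ‖z‖ ≤ A := hA ⟨z, rfl⟩
    have h2 : ‖(a • f) z‖ / v ‖z‖ = ‖a‖ * (‖f z‖ / v ‖z‖) := by
      simp [mul_div_assoc]
    simp only [h2]
    exact mul_le_mul_of_nonneg_left h1 (norm_nonneg a)

/-- The space `H_v(ℂ)`. It is a type of its own, so that it carries the topology of `‖·‖_v` and not
the topology of pointwise convergence of `ℂ → ℂ`. -/
def H (v : RadialWeight) : Type := v.subspace

instance (v : RadialWeight) : AddCommGroup v.H := inferInstanceAs (AddCommGroup v.subspace)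

instance (v : RadialWeight) : Module ℂ v.H := inferInstanceAs (Module ℂ v.subspace)

instance (v : RadialWeight) : CoeFun v.H (fun _ => ℂ → ℂ) := ⟨Subtype.val⟩

/-- The norm `‖f‖_v = sup_z |f(z)| / v(|z|)` on `H_v(ℂ)`. -/
noncomputable instance (v : RadialWeight) : Norm v.H :=
  ⟨fun f => ⨆ z : ℂ, ‖f z‖ / v ‖z‖⟩

theorem norm_def (v : RadialWeight) (f : v.H) :
    ‖f‖ = ⨆ z : ℂ, ‖f z‖ / v ‖z‖ := rfl

theorem div_le_norm (v : RadialWeight) (f : v.H) (z : ℂ) :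
    ‖f z‖ / v ‖z‖ ≤ ‖f‖ := le_ciSup f.2.2 z

theorem normedSpaceCore (v : RadialWeight) : NormedSpace.Core ℂ v.H where
  norm_nonneg f := Real.iSup_nonneg fun z => div_nonneg (norm_nonneg _) (v.pos_norm z).le
  norm_smul a f := by
    rw [norm_def, norm_def, Real.mul_iSup_of_nonneg (norm_nonneg a)]
    refine iSup_congr fun z => ?_
    rw [← mul_div_assoc, ← norm_smul]
    rfl
  norm_triangle f g := by
    rw [norm_def]
    refine ciSup_le fun z => ?_
    have h3 : ‖(f + g : v.H) z‖ / v ‖z‖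
        ≤ (‖f z‖ + ‖g z‖) / v ‖z‖ :=
      div_le_div_of_nonneg_right (norm_add_le _ _) (v.pos_norm z).le
    rw [add_div] at h3
    exact h3.trans (add_le_add (v.div_le_norm f z) (v.div_le_norm g z))
  norm_eq_zero_iff f := by
    constructor
    · intro h
      refine Subtype.ext (funext fun z => ?_)
      have h1 := v.div_le_norm f z
      rw [h, div_le_iff₀ (v.pos_norm z), zero_mul] at h1
      exact norm_le_zero_iff.1 h1
    · rintro rfl
      have h0 : ∀ z : ℂ, (0 : v.H) z = 0 := fun _ => rfl
      simp [norm_def, h0]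

noncomputable instance (v : RadialWeight) : NormedAddCommGroup v.H :=
  NormedAddCommGroup.ofCore v.normedSpaceCore

noncomputable instance (v : RadialWeight) : NormedSpace ℂ v.H :=
  NormedSpace.ofCore v.normedSpaceCore

/-- `w` is log-convex: `x ↦ log w(eˣ)` is convex on `ℝ`. -/
def IsLogConvex (w : RadialWeight) : Prop :=
  ConvexOn ℝ Set.univ fun x : ℝ => Real.log (w (Real.exp x))

/-- Clunie–Kővári weights: log-convex radial weights `w` with
`w(r) = w(1) exp ∫₁ʳ ω(ρ)/ρ dρ` for `r ≥ 1`, where `ω ≥ 0` is increasing on `[1, ∞)` and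
`ω(cr) - ω(r) ≥ 1` for some `c > 1` and all `r ≥ 1`. -/
def IsClunieKovari (w : RadialWeight) : Prop :=
  w.IsLogConvex ∧
    ∃ ω : ℝ → ℝ, MonotoneOn ω (Set.Ici 1) ∧ (∀ r, 1 ≤ r → 0 ≤ ω r) ∧
      (∀ r, 1 ≤ r → w r = w 1 * Real.exp (∫ ρ in (1 : ℝ)..r, ω ρ / ρ)) ∧
      ∃ c : ℝ, 1 < c ∧ ∀ r, 1 ≤ r → 1 ≤ ω (c * r) - ω r

end RadialWeight

/-- The integral `∫₀ᶻ f(ζ) dζ` along the segment from `0` to `z`, parametrized as `ζ = t z`,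
`0 ≤ t ≤ 1` (for entire `f` any rectifiable path gives the same value). -/
noncomputable def integrationOperator (f : ℂ → ℂ) (z : ℂ) : ℂ :=
  ∫ t in (0 : ℝ)..1, f ((t : ℂ) * z) * z

/-! Sufficiency is the estimate |If(z)| ≤ ‖f‖ ∫₀^|z| w (`norm_integrationOperator_le`). For
necessity it is enough to have one f in H_w with nonnegative Taylor coefficients and w ≤ A f on [r₀,
∞): then ∫ w over [r₀, r] is at most A · If(r) ≤ A ‖If‖ v(r), and the rest of ∫₀ʳ w is a constant.

To build f, put L(x) = log w(eˣ). The Clunie–Kővári condition says that the slopes of the convex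
function L grow by at least 1 over every interval of length log c in [0, ∞). Hence supporting lines
of consecutive integer slopes touch L at abscissae with bounded gaps (`exists_of_growth`). The
exponential of a line of slope n is a monomial a rⁿ in r = eˣ. A greedily thinned chain of lines
keeps the sum of these monomials below 4w, because away from their contact points they decay
geometrically (`tsum_term_le`). It also keeps the sum above a multiple of w, because each line of
the chain is the first admissible one (`le_max_line_next`). -/

/-- Lines of consecutive integer slopes `m, m + 1, …` supporting the graph of `L` from below, the
`n`-th one at the abscissa `x n`, where consecutive abscissae are at distance at most `D`. -/
structure SupportingLines (L : ℝ → ℝ) where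
  m : ℕ
  x : ℕ → ℝ
  D : ℝ
  line : ℕ → ℝ → ℝ
  line_sub : ∀ n y z, line n z = line n y + ((n : ℝ) + m) * (z - y)
  line_le : ∀ n y, line n y ≤ L y
  line_eq : ∀ n, line n (x n) = L (x n)
  mono : Monotone x
  step : ∀ n, x (n + 1) ≤ x n + D
  tendsto : Filter.Tendsto x Filter.atTop Filter.atTop

/-! ### Supporting lines of a convex function and the greedy chain. -/

namespace SupportingLines

variable {L : ℝ → ℝ} (S : SupportingLines L)

theorem line_succ_sub (n : ℕ) (y z : ℝ) :
    S.line (n + 1) z - S.line n z = S.line (n + 1) y - S.line n y + (z - y) := by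
  rw [S.line_sub (n + 1) y z, S.line_sub n y z]
  push_cast
  ring

theorem line_sub_mono {a b : ℕ} (hab : a ≤ b) {y z : ℝ} (hyz : y ≤ z) :
    S.line b y - S.line a y ≤ S.line b z - S.line a z := by
  have h : (a : ℝ) ≤ b := by exact_mod_cast hab
  rw [S.line_sub b y z, S.line_sub a y z]
  nlinarith [mul_nonneg (sub_nonneg.2 h) (sub_nonneg.2 hyz)]

theorem convexOn_sub_line (hL : ConvexOn ℝ Set.univ L) (n : ℕ) :
    ConvexOn ℝ Set.univ fun y => L y - S.line n y := by
  refine ⟨convex_univ, fun y _ z _ s t hs ht hst => ?_⟩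
  have h := hL.2 (Set.mem_univ y) (Set.mem_univ z) hs ht hst
  have h1 := S.line_sub n 0 y
  have h2 := S.line_sub n 0 z
  have h3 := S.line_sub n 0 (s • y + t • z)
  simp only [smul_eq_mul] at *
  rw [h1, h2, h3]
  have : s * S.line n 0 + t * S.line n 0 = S.line n 0 := by rw [← add_mul, hst, one_mul]
  linarith

theorem sub_line_le_of_right (hL : ConvexOn ℝ Set.univ L) {n : ℕ} {y z : ℝ} (hy : S.x n ≤ y)
    (hyz : y ≤ z) : L y - S.line n y ≤ L z - S.line n z := by
  have h := (S.convexOn_sub_line hL n).le_max_of_mem_Icc (Set.mem_univ (S.x n)) (Set.mem_univ z)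
    ⟨hy, hyz⟩
  have h0 := S.line_eq n
  have h1 := S.line_le n z
  rcases le_max_iff.1 h with h | h <;> linarith

theorem sub_line_le_of_left (hL : ConvexOn ℝ Set.univ L) {n : ℕ} {y z : ℝ} (hz : z ≤ y)
    (hy : y ≤ S.x n) : L y - S.line n y ≤ L z - S.line n z := by
  have h := (S.convexOn_sub_line hL n).le_max_of_mem_Icc (Set.mem_univ z) (Set.mem_univ (S.x n))
    ⟨hz, hy⟩
  have h0 := S.line_eq n
  have h1 := S.line_le n z
  rcases le_max_iff.1 h with h | h <;> linarith

/-- Left of its contact point the gap under line `n + 1` is largest at `x n`. There it is at most `x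
(n + 1) - x n ≤ D`, since the slopes differ by 1 and line `n` stays below `L`. -/
theorem le_line_succ_add (hL : ConvexOn ℝ Set.univ L) {n : ℕ} {y : ℝ} (h1 : S.x n ≤ y)
    (h2 : y ≤ S.x (n + 1)) : L y ≤ S.line (n + 1) y + S.D := by
  have h := S.sub_line_le_of_left hL h1 h2
  have e := S.line_succ_sub n (S.x n) (S.x (n + 1))
  have e1 := S.line_eq n
  have e2 := S.line_eq (n + 1)
  have e3 := S.line_le n (S.x (n + 1))
  have e4 := S.step n
  linarith

/-- The lines `a` and `m` lie at least `log 2` below `L` at each other's points of contact. -/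
def Separated (a m : ℕ) : Prop :=
  a < m ∧ S.line a (S.x m) + Real.log 2 ≤ L (S.x m) ∧ S.line m (S.x a) + Real.log 2 ≤ L (S.x a)

/-- Line `a + 1` gains on line `a` without bound to the right, and `L` lies above it; at `x a`,
steep lines `m` are low because they pass below `L` at `x a + 1`. -/
theorem exists_separated (a : ℕ) : ∃ m, S.Separated a m := by
  have h1 : ∀ᶠ m : ℕ in Filter.atTop, a < m := Filter.eventually_gt_atTop a
  have h2 := S.tendsto.eventually_ge_atTop
    (S.x a - (S.line (a + 1) (S.x a) - S.line a (S.x a)) + Real.log 2)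
  have h3 := (tendsto_natCast_atTop_atTop (R := ℝ)).eventually_ge_atTop
    (L (S.x a + 1) - L (S.x a) + Real.log 2)
  obtain ⟨m, h1, h2, h3⟩ := (h1.and (h2.and h3)).exists
  refine ⟨m, h1, ?_, ?_⟩
  · have e := S.line_succ_sub a (S.x a) (S.x m)
    have e1 := S.line_le (a + 1) (S.x m)
    linarith
  · have e := S.line_sub m (S.x a) (S.x a + 1)
    have e1 := S.line_le m (S.x a + 1)
    have e2 : (0 : ℝ) ≤ S.m := Nat.cast_nonneg _
    linarith

open Classical in
/-- The least line separated from the line `a`. -/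
noncomputable def next (a : ℕ) : ℕ := Nat.find (S.exists_separated a)

theorem separated_next (a : ℕ) : S.Separated a (S.next a) := by
  classical exact Nat.find_spec (S.exists_separated a)

theorem not_separated {a m : ℕ} (h : m < S.next a) : ¬ S.Separated a m := by
  classical exact Nat.find_min (S.exists_separated a) h

theorem le_max_line_next (hL : ConvexOn ℝ Set.univ L) {a : ℕ} {y : ℝ} (h1 : S.x a ≤ y)
    (h2 : y ≤ S.x (S.next a)) :
    L y ≤ max (S.line a y) (S.line (S.next a) y) + (2 * Real.log 2 + 2 * S.D) := by
  have hlog : 0 < Real.log 2 := Real.log_pos one_lt_two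
  have hD : 0 ≤ S.D := by linarith [S.step 0, S.mono (Nat.le_succ 0)]
  -- The predecessor `m` of `next a` fails to be separated from `a`; each way of failing puts `L`
  -- within log 2 of line `a` or of line `m` on `[x a, x m]`.
  obtain ⟨m, hm⟩ : ∃ m, S.next a = m + 1 := Nat.exists_eq_add_of_lt
    (lt_of_le_of_lt (Nat.zero_le a) (S.separated_next a).1) |>.imp fun k hk => by omega
  have ham : a ≤ m := by have := (S.separated_next a).1; omega
  have hns : ¬ S.Separated a m := S.not_separated (by omega)
  rw [hm] at h2 ⊢
  have hl := le_max_left (S.line a y) (S.line (m + 1) y)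
  have hr := le_max_right (S.line a y) (S.line (m + 1) y)
  rcases le_total (S.x m) y with hy | hy
  · linarith [S.le_line_succ_add hL hy h2]
  rcases ham.eq_or_lt with rfl | ham
  · linarith [S.le_line_succ_add hL h1 h2]
  simp only [Separated, ham, true_and, not_and_or, not_le] at hns
  rcases hns with hns | hns
  · linarith [S.sub_line_le_of_right hL h1 hy]
  -- Here line `m` is within log 2 of `L` at `x a`. Comparison with line `m - 1` forces `x (m - 1) -
  -- x a ≤ log 2`, so `x (m + 1) - x a ≤ log 2 + 2D`, which bounds the loss in passing from line `m`
  -- to line `m + 1`.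
  · obtain ⟨k, rfl⟩ : ∃ k, m = k + 1 := ⟨m - 1, by omega⟩
    have e1 := S.line_succ_sub k (S.x k) (S.x a)
    have e2 := S.line_eq k
    have e3 := S.line_le (k + 1) (S.x k)
    have e4 := S.line_le k (S.x a)
    have e5 := S.step k
    have e6 := S.step (k + 1)
    have e7 := S.line_succ_sub (k + 1) (S.x (k + 1 + 1)) y
    have e8 := S.line_eq (k + 1 + 1)
    have e9 := S.line_le (k + 1) (S.x (k + 1 + 1))
    have e10 := S.sub_line_le_of_left hL h1 hy
    linarith

/-- The greedily chosen chain of successively separated lines. -/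
noncomputable def chain : ℕ → ℕ
  | 0 => 0
  | k + 1 => S.next (chain k)

theorem chain_strictMono : StrictMono S.chain :=
  strictMono_nat_of_lt_succ fun k => (S.separated_next (S.chain k)).1

/-- The exponential of the `k`-th line of the chain. -/
noncomputable def term (k : ℕ) (y : ℝ) : ℝ := Real.exp (S.line (S.chain k) y)

theorem term_le (k : ℕ) (y : ℝ) : S.term k y ≤ Real.exp (L y) := Real.exp_le_exp.2 (S.line_le _ _)

theorem two_mul_exp_le {a b : ℝ} (h : a + Real.log 2 ≤ b) : 2 * Real.exp a ≤ Real.exp b := by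
  have := Real.exp_le_exp.2 h
  rwa [Real.exp_add, Real.exp_log two_pos, mul_comm] at this

/-- Separation gives the factor 2 at the contact point, and the steeper line only gains further to
the right. -/
theorem two_mul_term_le_succ {k : ℕ} {y : ℝ} (hy : S.x (S.chain (k + 1)) ≤ y) :
    2 * S.term k y ≤ S.term (k + 1) y := by
  refine two_mul_exp_le ?_
  have h := (S.separated_next (S.chain k))
  have h1 := S.line_sub_mono h.1.le hy
  have h2 := S.line_eq (S.chain (k + 1))
  change S.line _ y + _ ≤ S.line (S.next (S.chain k)) y
  change S.x (S.next (S.chain k)) ≤ y at hy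
  change S.line (S.next (S.chain k)) (S.x (S.next (S.chain k))) = _ at h2
  have h3 := h.2.1
  change _ ≤ L (S.x (S.next (S.chain k))) at h3
  have h4 : S.line (S.next (S.chain k)) (S.x (S.next (S.chain k))) -
    S.line (S.chain k) (S.x (S.next (S.chain k))) ≤
    S.line (S.next (S.chain k)) y - S.line (S.chain k) y := h1
  have h5 : L (S.x (S.chain (k + 1))) = L (S.x (S.next (S.chain k))) := rfl
  linarith

theorem two_mul_term_succ_le {k : ℕ} {y : ℝ} (hy : y ≤ S.x (S.chain k)) :
    2 * S.term (k + 1) y ≤ S.term k y := by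
  refine two_mul_exp_le ?_
  have h := (S.separated_next (S.chain k))
  have h1 := S.line_sub_mono h.1.le hy
  have h2 := S.line_eq (S.chain k)
  have h3 := h.2.2
  change S.line (S.next (S.chain k)) y + _ ≤ _
  linarith

theorem sum_range_term_le {k : ℕ} {y : ℝ} (hy : S.x (S.chain k) ≤ y) :
    ∑ i ∈ Finset.range k, S.term i y ≤ S.term k y := by
  induction k with
  | zero => simpa [term] using (Real.exp_pos _).le
  | succ k ih =>
    rw [Finset.sum_range_succ]
    have h := ih ((S.mono (S.chain_strictMono (Nat.lt_succ_self k)).le).trans hy)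
    linarith [S.two_mul_term_le_succ hy]

theorem term_add_le {k : ℕ} {y : ℝ} (hy : y ≤ S.x (S.chain k)) (i : ℕ) :
    S.term (k + i) y ≤ S.term k y * (1 / 2) ^ i := by
  induction i with
  | zero => simp
  | succ i ih =>
    have h := S.two_mul_term_succ_le (hy.trans (S.mono (S.chain_strictMono.monotone
      (Nat.le_add_right k i))))
    rw [pow_succ, ← add_assoc]
    linarith

theorem tendsto_x_chain : Filter.Tendsto (fun k => S.x (S.chain k)) Filter.atTop Filter.atTop :=
  S.tendsto.comp S.chain_strictMono.tendsto_atTop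

theorem summable_term (y : ℝ) : Summable fun k => S.term k y := by
  obtain ⟨k, hk⟩ := (S.tendsto_x_chain.eventually_ge_atTop y).exists
  rw [← summable_nat_add_iff k]
  refine Summable.of_nonneg_of_le (fun i => (Real.exp_pos _).le) (fun i => ?_)
    (summable_geometric_two.mul_left (S.term k y))
  rw [add_comm i k]
  exact S.term_add_le hk i

theorem tsum_term_add_le {k : ℕ} {y : ℝ} (hy : y ≤ S.x (S.chain k)) :
    ∑' i, S.term (i + k) y ≤ 2 * S.term k y := by
  have h := Summable.tsum_le_tsum (fun i => S.term_add_le hy i)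
    (by simpa only [add_comm] using (summable_nat_add_iff k).2 (S.summable_term y))
    (summable_geometric_two.mul_left (S.term k y))
  rw [tsum_mul_left, tsum_geometric_two] at h
  simpa only [add_comm, mul_comm] using h

theorem exists_mem_Icc {y : ℝ} (hy : S.x 0 ≤ y) :
    ∃ k, S.x (S.chain k) ≤ y ∧ y ≤ S.x (S.chain (k + 1)) := by
  classical
  have hex : ∃ k, y ≤ S.x (S.chain (k + 1)) := by
    obtain ⟨k, hk⟩ := (S.tendsto_x_chain.eventually_ge_atTop y).exists
    exact ⟨k, hk.trans (S.mono (S.chain_strictMono.monotone (Nat.le_succ k)))⟩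
  refine ⟨Nat.find hex, ?_, Nat.find_spec hex⟩
  rcases h : Nat.find hex with _ | j
  · exact hy
  · exact (not_le.1 (Nat.find_min hex (m := j) (by omega))).le

theorem tsum_term_le (y : ℝ) : ∑' k, S.term k y ≤ 4 * Real.exp (L y) := by
  rcases le_total y (S.x 0) with hy | hy
  · have h := S.tsum_term_add_le (k := 0) hy
    have h1 := S.term_le 0 y
    have h2 := Real.exp_pos (L y)
    simp only [add_zero] at h
    linarith
  · obtain ⟨k, h1, h2⟩ := S.exists_mem_Icc hy
    rw [← (S.summable_term y).sum_add_tsum_nat_add (k + 1), Finset.sum_range_succ]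
    -- The terms up to `k` contribute at most `2 * term k`, those from `k + 1` on at most `2 * term
    -- (k + 1)`.
    linarith [S.sum_range_term_le h1, S.tsum_term_add_le h2, S.term_le k y, S.term_le (k + 1) y]

theorem exp_le_tsum_term (hL : ConvexOn ℝ Set.univ L) {y : ℝ} (hy : S.x 0 ≤ y) :
    Real.exp (L y) ≤ Real.exp (2 * Real.log 2 + 2 * S.D) * ∑' k, S.term k y := by
  obtain ⟨k, h1, h2⟩ := S.exists_mem_Icc hy
  have h := Real.exp_le_exp.2 (S.le_max_line_next hL h1 h2)
  rw [add_comm, Real.exp_add] at h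
  refine h.trans (mul_le_mul_of_nonneg_left ?_ (Real.exp_pos _).le)
  have hk : ∀ j, S.term j y ≤ ∑' k, S.term k y := fun j =>
    (S.summable_term y).le_tsum j fun i _ => (Real.exp_pos _).le
  rcases max_choice (S.line (S.chain k) y) (S.line (S.next (S.chain k)) y) with h | h <;> rw [h]
  · exact hk k
  · exact hk (k + 1)

/-- A convex function that is bounded below, grows faster than every linear function, and whose
slopes increase by at least `1` over each interval of length `d`, has supporting lines. -/
theorem exists_of_growth (hL : ConvexOn ℝ Set.univ L) {ℓ : ℝ} (hℓ : ∀ y, ℓ ≤ L y)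
    (hg : ∀ n : ℕ, ∀ᶠ y in Filter.atTop, n * y ≤ L y) {d : ℝ} (hd : 0 < d)
    (hs : ∀ y h, 0 ≤ y → 0 ≤ h → L (y + h) - L y + h ≤ L (y + d + h) - L (y + d)) :
    ∃ S : SupportingLines L, 0 < S.m := by
  have hc : Continuous L := continuousOn_univ.1 (hL.continuousOn isOpen_univ)
  -- A supporting line of slope `n + 1` touches where `L y - (n + 1) y` is minimal. The slope is
  -- positive because `L` is only bounded below at -∞.
  have hmin : ∀ n : ℕ, ∃ x, ∀ y, L x - ((n + 1 : ℕ) : ℝ) * x ≤ L y - ((n + 1 : ℕ) : ℝ) * y := by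
    intro n
    refine Continuous.exists_forall_le (f := fun y => L y - ((n + 1 : ℕ) : ℝ) * y) (by fun_prop) ?_
    rw [cocompact_eq_atBot_atTop, Filter.tendsto_sup]
    constructor
    · refine Filter.tendsto_atTop_mono' _ ?_
        (Filter.tendsto_atTop_add_const_left _ ℓ Filter.tendsto_neg_atBot_atTop)
      filter_upwards [Filter.eventually_le_atBot 0] with y hy
      have := hℓ y
      push_cast
      nlinarith [mul_nonneg (Nat.cast_nonneg (α := ℝ) n) (neg_nonneg.2 hy)]
    · refine Filter.tendsto_atTop_mono' _ ?_ Filter.tendsto_id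
      filter_upwards [hg (n + 2)] with y hy
      push_cast at hy ⊢
      simp only [id]
      linarith
  choose x hx using hmin
  have hmono : Monotone x := by
    refine monotone_nat_of_le_succ fun n => ?_
    have h1 := hx n (x (n + 1))
    have h2 := hx (n + 1) (x n)
    push_cast at h1 h2
    linarith
  have htend : Filter.Tendsto x Filter.atTop Filter.atTop := by
    refine Filter.tendsto_atTop.2 fun X => ?_
    filter_upwards [(tendsto_natCast_atTop_atTop (R := ℝ)).eventually_ge_atTop
      (L (X + 1) - ℓ)] with n hn
    by_contra! hX
    have h1 := hx n (X + 1)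
    have h2 := hℓ (x n)
    push_cast at h1
    nlinarith [mul_nonneg (by positivity : (0 : ℝ) ≤ n + 1) (sub_nonneg.2 hX.le)]
  obtain ⟨p, hp⟩ := (htend.eventually_ge_atTop 0).exists
  have hp' : ∀ n, 0 ≤ x (n + p) := fun n => hp.trans (hmono (Nat.le_add_left p n))
  -- The shift by `p` puts all contact points in `[0, ∞)`, where slope growth is available. With gap
  -- `2 * d` the slope rises by 2, contradicting consecutive integer slopes; gap `d` would give no
  -- strict contradiction.
  refine ⟨⟨p + 1, fun n => x (n + p), 2 * d,
    fun n y => L (x (n + p)) + ((n : ℝ) + (p + 1 : ℕ)) * (y - x (n + p)), fun n y z => by ring,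
    fun n y => ?_, fun n => by simp, fun a b hab => hmono (by omega), fun n => ?_,
    htend.comp (Filter.tendsto_add_atTop_nat p)⟩, Nat.succ_pos p⟩
  · have := hx (n + p) y
    push_cast at this ⊢
    linarith
  · by_contra! hlt
    set a := x (n + p) with ha
    have hb : x (n + 1 + p) = x (n + p + 1) := by rw [add_right_comm]
    rw [hb] at hlt
    set b := x (n + p + 1) with hb'
    have h0 : 0 ≤ a := hp' n
    obtain ⟨h, hh⟩ : ∃ h, b = a + d + d + h := ⟨b - a - d - d, by ring⟩
    have hpos : 0 < h := by linarith
    have e1 := hs a h h0 hpos.le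
    have e2 := hs (a + d) h (by linarith) hpos.le
    have e3 := hx (n + p) (a + h)
    have e4 := hx (n + p + 1) (a + d + d)
    rw [← ha] at e3
    rw [← hb', hh] at e4
    push_cast at e3 e4
    linarith

end SupportingLines

/-! ### The lacunary entire function. -/

namespace SupportingLines

variable {L : ℝ → ℝ} (S : SupportingLines L)

/-- The Taylor coefficient at the `k`-th line of the chain. -/
noncomputable def coeff (k : ℕ) : ℝ := Real.exp (S.line (S.chain k) 0)

/-- The lacunary power series with nonnegative coefficients, on the positive reals. -/
noncomputable def series (r : ℝ) : ℝ := ∑' k, S.coeff k * r ^ (S.chain k + S.m)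

/-- The lacunary power series with nonnegative coefficients, as an entire function. -/
noncomputable def entire (z : ℂ) : ℂ := ∑' k, (S.coeff k : ℂ) * z ^ (S.chain k + S.m)

theorem coeff_pos (k : ℕ) : 0 < S.coeff k := Real.exp_pos _

theorem coeff_mul_pow {r : ℝ} (hr : 0 < r) (k : ℕ) :
    S.coeff k * r ^ (S.chain k + S.m) = S.term k (Real.log r) := by
  rw [coeff, term, S.line_sub (S.chain k) 0 (Real.log r), Real.exp_add, sub_zero,
    mul_comm _ (Real.log r), ← Nat.cast_add, mul_comm (Real.log r), Real.exp_nat_mul,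
    Real.exp_log hr]

theorem series_eq {r : ℝ} (hr : 0 < r) : S.series r = ∑' k, S.term k (Real.log r) :=
  tsum_congr fun k => S.coeff_mul_pow hr k

theorem summable_series (r : ℝ) : Summable fun k => S.coeff k * r ^ (S.chain k + S.m) := by
  have h : Summable fun k => S.coeff k * (|r| + 1) ^ (S.chain k + S.m) := by
    simpa only [S.coeff_mul_pow (by positivity : 0 < |r| + 1)] using S.summable_term _
  refine Summable.of_norm_bounded h fun k => ?_
  rw [norm_mul, norm_pow, Real.norm_eq_abs, Real.norm_eq_abs, abs_of_pos (S.coeff_pos k)]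
  exact mul_le_mul_of_nonneg_left (pow_le_pow_left₀ (abs_nonneg r) (by linarith) _)
    (Real.exp_pos _).le

theorem norm_coeff_mul_pow (z : ℂ) (k : ℕ) :
    ‖(S.coeff k : ℂ) * z ^ (S.chain k + S.m)‖ = S.coeff k * ‖z‖ ^ (S.chain k + S.m) := by
  rw [norm_mul, norm_pow, Complex.norm_real, Real.norm_eq_abs, abs_of_pos (S.coeff_pos k)]

theorem entire_ofReal (r : ℝ) : S.entire r = S.series r := by
  rw [entire, series, Complex.ofReal_tsum]
  push_cast
  rfl

theorem norm_entire_le (z : ℂ) : ‖S.entire z‖ ≤ S.series ‖z‖ :=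
  tsum_of_norm_bounded (S.summable_series ‖z‖).hasSum fun k => (S.norm_coeff_mul_pow z k).le

theorem series_nonneg {r : ℝ} (hr : 0 ≤ r) : 0 ≤ S.series r :=
  tsum_nonneg fun _ => mul_nonneg (Real.exp_pos _).le (pow_nonneg hr _)

theorem differentiable_entire : Differentiable ℂ S.entire := by
  intro z
  have h : DifferentiableOn ℂ S.entire (Metric.ball 0 (‖z‖ + 1)) := by
    refine Complex.differentiableOn_tsum_of_summable_norm (S.summable_series (‖z‖ + 1))
      (fun k => by fun_prop) Metric.isOpen_ball fun k y hy => ?_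
    rw [S.norm_coeff_mul_pow]
    exact mul_le_mul_of_nonneg_left (pow_le_pow_left₀ (norm_nonneg y)
      (mem_ball_zero_iff.1 hy).le _) (Real.exp_pos _).le
  exact h.differentiableAt (Metric.isOpen_ball.mem_nhds (mem_ball_zero_iff.2 (by linarith)))

theorem continuous_series : Continuous S.series := by
  have h : S.series = fun r : ℝ => (S.entire r).re := by
    ext r
    rw [S.entire_ofReal, Complex.ofReal_re]
  rw [h]
  exact Complex.continuous_re.comp (S.differentiable_entire.continuous.comp Complex.continuous_ofReal)

end SupportingLines

/-! ### Clunie–Kővári weights have supporting lines. -/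

namespace RadialWeight

theorem IsClunieKovari.exists_supportingLines {w : RadialWeight} (hw : w.IsClunieKovari) :
    ∃ S : SupportingLines fun x => Real.log (w (Real.exp x)), 0 < S.m := by
  obtain ⟨hL, ω, hmono, -, hrep, c, hc, hωc⟩ := hw
  have hℓ : ∀ y, Real.log (w 0) ≤ Real.log (w (Real.exp y)) := fun y =>
    Real.log_le_log (w.pos 0 le_rfl)
      (w.monotoneOn (Set.mem_Ici.2 le_rfl) (Real.exp_pos y).le (Real.exp_pos y).le)
  refine SupportingLines.exists_of_growth hL hℓ (fun n => ?_) (Real.log_pos hc) ?_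
  · have h := Real.tendsto_exp_atTop.eventually
      ((Asymptotics.isLittleO_iff.1 w.log_isLittleO) (by positivity : (0 : ℝ) < 1 / (n + 1)))
    filter_upwards [h, Filter.eventually_gt_atTop (|Real.log (w 0)|)] with y hy hy0
    have hy1 : 0 < y := (abs_nonneg _).trans_lt hy0
    rw [Real.log_exp, Real.norm_eq_abs, Real.norm_eq_abs, abs_of_pos hy1, one_div, inv_mul_eq_div,
      le_div_iff₀ (by positivity)] at hy
    rcases le_total 0 (Real.log (w (Real.exp y))) with h0 | h0
    · rw [abs_of_nonneg h0] at hy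
      linarith
    · exfalso
      rw [abs_of_nonpos h0] at hy
      have h1 := hℓ y
      have h2 := neg_abs_le (Real.log (w 0))
      nlinarith [mul_nonneg hy1.le (Nat.cast_nonneg (α := ℝ) n)]
  · intro y h hy hh
    have hc0 : 0 < c := by linarith
    have hint : ∀ a b, 1 ≤ a → a ≤ b →
        IntervalIntegrable (fun ρ => ω ρ / ρ) MeasureTheory.volume a b := by
      intro a b ha hab
      have h1 : IntervalIntegrable ω MeasureTheory.volume a b := by
        refine MonotoneOn.intervalIntegrable (hmono.mono ?_)
        rw [Set.uIcc_of_le hab]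
        exact fun t ht => ha.trans ht.1
      simp only [div_eq_mul_inv]
      refine h1.mul_continuousOn (continuousOn_id.inv₀ fun t ht => ?_)
      rw [Set.uIcc_of_le hab] at ht
      exact (by linarith [ht.1] : (0 : ℝ) < t).ne'
    have hlog : ∀ a b, 1 ≤ a → a ≤ b →
        Real.log (w b) - Real.log (w a) = ∫ ρ in a..b, ω ρ / ρ := by
      intro a b ha hab
      have h1 := (w.pos 1 zero_le_one).ne'
      rw [hrep b (ha.trans hab), hrep a ha, Real.log_mul h1 (Real.exp_ne_zero _),
        Real.log_mul h1 (Real.exp_ne_zero _), Real.log_exp, Real.log_exp,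
        ← intervalIntegral.integral_add_adjacent_intervals (hint 1 a le_rfl ha) (hint a b ha hab)]
      ring
    set a := Real.exp y with ha
    set b := Real.exp (y + h) with hb
    have ha1 : 1 ≤ a := Real.one_le_exp hy
    have hab : a ≤ b := Real.exp_le_exp.2 (by linarith)
    have e1 : Real.exp (y + Real.log c + h) = c * b := by
      rw [hb, show y + Real.log c + h = Real.log c + (y + h) by ring, Real.exp_add, Real.exp_log hc0]
    have e2 : Real.exp (y + Real.log c) = c * a := by
      rw [ha, add_comm, Real.exp_add, Real.exp_log hc0]
    have hca : 1 ≤ c * a := by nlinarith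
    have hcab : c * a ≤ c * b := mul_le_mul_of_nonneg_left hab hc0.le
    have hInv : IntervalIntegrable (fun t : ℝ => 1 / t) MeasureTheory.volume a b := by
      refine intervalIntegral.intervalIntegrable_one_div (fun t ht => ?_) continuousOn_id
      rw [Set.uIcc_of_le hab] at ht
      exact (by linarith [ht.1] : (0 : ℝ) < t).ne'
    have e3 : h = ∫ t in a..b, 1 / t := by
      rw [integral_one_div_of_pos (by linarith) (by linarith), ha, hb, ← Real.exp_sub, Real.log_exp]
      ring
    -- Substituting `ρ = c t` puts both increments of `L` over the same interval, so the slope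
    -- growth reduces to `ω t + 1 ≤ ω (c t)`.
    have hscale : ∫ ρ in (c * a)..(c * b), ω ρ / ρ = ∫ t in a..b, ω (c * t) / t := by
      rw [← intervalIntegral.mul_integral_comp_mul_left, ← intervalIntegral.integral_const_mul]
      refine intervalIntegral.integral_congr fun t _ => ?_
      rw [mul_div_assoc', mul_div_mul_left _ _ hc0.ne']
    have hInt2 : IntervalIntegrable (fun t => ω (c * t) / t) MeasureTheory.volume a b := by
      have h1 := ((hint (c * a) (c * b) hca hcab).comp_mul_left (c := c)).const_mul c
      rw [mul_div_cancel_left₀ _ hc0.ne', mul_div_cancel_left₀ _ hc0.ne'] at h1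
      refine h1.congr fun t _ => ?_
      rw [mul_div_assoc', mul_div_mul_left _ _ hc0.ne']
    rw [e1, e2, hlog a b ha1 hab, hlog _ _ hca hcab, hscale]
    nth_rewrite 1 [e3]
    rw [← intervalIntegral.integral_add (hint a b ha1 hab) hInv]
    refine intervalIntegral.integral_mono_on hab ((hint a b ha1 hab).add hInv) hInt2 fun t ht => ?_
    have ht0 : 0 < t := by linarith [ht.1]
    rw [← add_div]
    exact div_le_div_of_nonneg_right (by linarith [hωc t (ha1.trans ht.1)]) ht0.le

end RadialWeight

/-! ### The integration operator on entire functions. -/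

theorem integrationOperator_add {f g : ℂ → ℂ} (hf : Continuous f) (hg : Continuous g) (z : ℂ) :
    integrationOperator (f + g) z = integrationOperator f z + integrationOperator g z := by
  unfold integrationOperator
  rw [← intervalIntegral.integral_add]
  · simp only [Pi.add_apply, add_mul]
  all_goals exact (Continuous.intervalIntegrable (by fun_prop) _ _)

theorem integrationOperator_smul (a : ℂ) (f : ℂ → ℂ) (z : ℂ) :
    integrationOperator (a • f) z = a * integrationOperator f z := by
  unfold integrationOperator
  rw [← intervalIntegral.integral_const_mul]
  simp only [Pi.smul_apply, smul_eq_mul, mul_assoc]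

theorem differentiable_integrationOperator {f : ℂ → ℂ} (hf : Differentiable ℂ f) :
    Differentiable ℂ (integrationOperator f) := by
  intro z
  -- On a disc containing `z` the operator differs from a primitive of `f` by a constant.
  obtain ⟨F, hF⟩ := (hf.differentiableOn (s := Metric.ball 0 (‖z‖ + 1))).isExactOn_ball
  have hFz : ∀ y ∈ Metric.ball (0 : ℂ) (‖z‖ + 1), integrationOperator f y = F y - F 0 := by
    intro y hy
    have hd : ∀ t ∈ Set.uIcc (0 : ℝ) 1, HasDerivAt (fun t : ℝ => F (t * y)) (f (t * y) * y) t := by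
      intro t ht
      rw [Set.uIcc_of_le zero_le_one] at ht
      have hm : (t : ℂ) * y ∈ Metric.ball (0 : ℂ) (‖z‖ + 1) := by
        rw [mem_ball_zero_iff] at hy ⊢
        rw [norm_mul, Complex.norm_real, Real.norm_eq_abs, abs_of_nonneg ht.1]
        exact (mul_le_of_le_one_left (norm_nonneg y) ht.2).trans_lt hy
      have h1 : HasDerivAt (fun t : ℝ => (t : ℂ) * y) y t := by
        simpa using (Complex.ofRealCLM.hasDerivAt (x := t)).mul_const y
      exact (hF _ hm).comp t h1
    have hc : Continuous f := hf.continuous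
    have h := intervalIntegral.integral_eq_sub_of_hasDerivAt hd
      (Continuous.intervalIntegrable (by fun_prop) _ _)
    simpa [integrationOperator] using h
  have hz : z ∈ Metric.ball (0 : ℂ) (‖z‖ + 1) := mem_ball_zero_iff.2 (by linarith)
  refine ((hF z hz).differentiableAt.sub_const (F 0)).congr_of_eventuallyEq ?_
  filter_upwards [Metric.isOpen_ball.mem_nhds hz] with y hy using hFz y hy

theorem integrationOperator_ofReal {f : ℂ → ℂ} {g : ℝ → ℝ} (h : ∀ t : ℝ, f t = g t) (r : ℝ) :
    integrationOperator f r = ((∫ t in (0 : ℝ)..r, g t : ℝ) : ℂ) := by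
  have h1 : ∫ t in (0 : ℝ)..r, g t = ∫ t in (0 : ℝ)..1, g (t * r) * r := by
    have := intervalIntegral.mul_integral_comp_mul_right (a := 0) (b := 1) (f := g) r
    rw [zero_mul, one_mul] at this
    rw [← this, intervalIntegral.integral_mul_const, mul_comm]
  rw [h1, ← intervalIntegral.integral_ofReal]
  refine intervalIntegral.integral_congr fun t _ => ?_
  rw [← Complex.ofReal_mul, h, Complex.ofReal_mul]

/-! ### The two implications. -/

namespace RadialWeight

theorem intervalIntegrable (w : RadialWeight) {a b : ℝ} (ha : 0 ≤ a) (hab : a ≤ b) :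
    IntervalIntegrable w MeasureTheory.volume a b := by
  refine (w.continuousOn.mono ?_).intervalIntegrable
  rw [Set.uIcc_of_le hab]
  exact fun t ht => ha.trans ht.1

theorem integral_mono_right (w : RadialWeight) {a b : ℝ} (ha : 0 ≤ a) (hab : a ≤ b) :
    ∫ t in (0 : ℝ)..a, w t ≤ ∫ t in (0 : ℝ)..b, w t := by
  rw [← intervalIntegral.integral_add_adjacent_intervals (w.intervalIntegrable le_rfl ha)
    (w.intervalIntegrable ha hab)]
  exact le_add_of_nonneg_right (intervalIntegral.integral_nonneg hab fun t ht =>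
    (w.pos t (ha.trans ht.1)).le)

theorem integral_nonneg (w : RadialWeight) {r : ℝ} (hr : 0 ≤ r) : 0 ≤ ∫ t in (0 : ℝ)..r, w t :=
  intervalIntegral.integral_nonneg hr fun t ht => (w.pos t ht.1).le

theorem norm_apply_le (v : RadialWeight) (f : v.H) (z : ℂ) : ‖f z‖ ≤ ‖f‖ * v ‖z‖ :=
  (div_le_iff₀ (v.pos_norm z)).1 (v.div_le_norm f z)

theorem norm_integrationOperator_le (w : RadialWeight) (f : w.H) (z : ℂ) :
    ‖integrationOperator f z‖ ≤ ‖f‖ * ∫ t in (0 : ℝ)..‖z‖, w t := by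
  have h1 : ∫ t in (0 : ℝ)..‖z‖, w t = ∫ t in (0 : ℝ)..1, w (t * ‖z‖) * ‖z‖ := by
    have := intervalIntegral.mul_integral_comp_mul_right (a := 0) (b := 1) (f := w) ‖z‖
    rw [zero_mul, one_mul] at this
    rw [← this, intervalIntegral.integral_mul_const, mul_comm]
  rw [h1, ← intervalIntegral.integral_const_mul]
  refine intervalIntegral.norm_integral_le_of_norm_le zero_le_one ?_ ?_
  · refine Filter.Eventually.of_forall fun t ht => ?_
    rw [norm_mul, ← mul_assoc]
    refine mul_le_mul_of_nonneg_right ?_ (norm_nonneg z)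
    have h := w.norm_apply_le f (t * z)
    rwa [norm_mul, Complex.norm_real, Real.norm_eq_abs, abs_of_pos ht.1] at h
  · refine ContinuousOn.intervalIntegrable (continuousOn_const.mul (ContinuousOn.mul
      (w.continuousOn.comp (by fun_prop) fun t ht => ?_) continuousOn_const))
    rw [Set.uIcc_of_le zero_le_one] at ht
    exact mul_nonneg ht.1 (norm_nonneg z)

/-- A bound `∫₀ʳ w ≤ C v(r)` for all `r ≥ 0` makes the integration operator bounded. -/
theorem exists_continuousLinearMap {w v : RadialWeight} {C : ℝ}
    (hC : ∀ r, 0 ≤ r → ∫ t in (0 : ℝ)..r, w t ≤ C * v r) :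
    ∃ T : w.H →L[ℂ] v.H, ∀ (f : w.H) (z : ℂ), T f z = integrationOperator f z := by
  have hbd : ∀ (f : w.H) (z : ℂ), ‖integrationOperator f z‖ / v ‖z‖ ≤ C * ‖f‖ := by
    intro f z
    rw [div_le_iff₀ (v.pos_norm z)]
    calc _ ≤ ‖f‖ * ∫ t in (0 : ℝ)..‖z‖, w t := w.norm_integrationOperator_le f z
      _ ≤ ‖f‖ * (C * v ‖z‖) := mul_le_mul_of_nonneg_left (hC _ (norm_nonneg z)) (norm_nonneg f)
      _ = _ := by ring
  let T : w.H →ₗ[ℂ] v.H :=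
    { toFun := fun f => ⟨integrationOperator f, differentiable_integrationOperator f.2.1,
        C * ‖f‖, by rintro _ ⟨z, rfl⟩; exact hbd f z⟩
      map_add' := fun f g => Subtype.ext (funext fun z =>
        integrationOperator_add f.2.1.continuous g.2.1.continuous z)
      map_smul' := fun a f => Subtype.ext (funext fun z => integrationOperator_smul a f z) }
  exact ⟨T.mkContinuous C fun f => ciSup_le fun z => hbd f z, fun f z => rfl⟩

theorem exists_bound_of_limsup_lt_top {w v : RadialWeight}
    (h : Filter.limsup (fun r : ℝ => (((1 / v r) * ∫ t in (0 : ℝ)..r, w t : ℝ) : EReal))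
      Filter.atTop < ⊤) :
    ∃ C, ∀ r, 0 ≤ r → ∫ t in (0 : ℝ)..r, w t ≤ C * v r := by
  obtain ⟨M, hM, -⟩ := EReal.lt_iff_exists_real_btwn.1 h
  obtain ⟨R, hR⟩ := Filter.eventually_atTop.1 (Filter.eventually_lt_of_limsup_lt hM)
  have hv0 := v.pos 0 le_rfl
  set J := ∫ t in (0 : ℝ)..(max R 0), w t with hJ
  have hJ0 : 0 ≤ J := w.integral_nonneg (le_max_right _ _)
  -- `M` serves for `r ≥ R`; for smaller `r` the integral is at most `J`, while `v r ≥ v 0 > 0`.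
  refine ⟨max M (J / v 0), fun r hr => ?_⟩
  have hvr := v.pos r hr
  rcases le_total R r with hRr | hRr
  · have h1 := EReal.coe_lt_coe_iff.1 (hR r hRr)
    rw [one_div, inv_mul_eq_div, div_lt_iff₀ hvr] at h1
    exact h1.le.trans (mul_le_mul_of_nonneg_right (le_max_left _ _) hvr.le)
  · calc _ ≤ J := w.integral_mono_right hr (hRr.trans (le_max_left _ _))
      _ = J / v 0 * v 0 := by field_simp
      _ ≤ J / v 0 * v r := mul_le_mul_of_nonneg_left
          (v.monotoneOn (Set.mem_Ici.2 le_rfl) hr hr) (div_nonneg hJ0 hv0.le)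
      _ ≤ _ := mul_le_mul_of_nonneg_right (le_max_right _ _) hvr.le

/-- A Clunie–Kővári weight is comparable, on a neighbourhood of infinity, with an entire function
with nonnegative Taylor coefficients. -/
theorem IsClunieKovari.exists_entire {w : RadialWeight} (hw : w.IsClunieKovari) :
    ∃ (f : w.H) (g : ℝ → ℝ) (r₀ A : ℝ), Continuous g ∧ (∀ t : ℝ, f t = g t) ∧
      (∀ t, 0 ≤ t → 0 ≤ g t) ∧ 0 < r₀ ∧ 0 < A ∧ ∀ t, r₀ ≤ t → w t ≤ A * g t := by
  obtain ⟨S, hm⟩ := hw.exists_supportingLines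
  have hwe : ∀ r, 0 < r → Real.exp (Real.log (w (Real.exp (Real.log r)))) = w r := fun r hr => by
    rw [Real.exp_log hr, Real.exp_log (w.pos r hr.le)]
  have hbd : ∀ z : ℂ, ‖S.entire z‖ / w ‖z‖ ≤ 4 := by
    intro z
    rw [div_le_iff₀ (w.pos_norm z)]
    rcases eq_or_ne z 0 with rfl | hz
    -- The origin has no logarithmic coordinate; the series vanishes there since all exponents are
    -- at least `S.m > 0`.
    · have : S.entire 0 = 0 := by simp [SupportingLines.entire, hm.ne']
      rw [this, norm_zero]
      exact mul_nonneg (by norm_num) (w.pos 0 le_rfl).le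
    · have hz' := norm_pos_iff.2 hz
      have h := S.tsum_term_le (Real.log ‖z‖)
      rw [hwe _ hz', ← S.series_eq hz'] at h
      exact (S.norm_entire_le z).trans h
  refine ⟨⟨S.entire, S.differentiable_entire, 4, by rintro _ ⟨z, rfl⟩; exact hbd z⟩, S.series,
    Real.exp (S.x 0), _, S.continuous_series, S.entire_ofReal, fun t ht => S.series_nonneg ht,
    Real.exp_pos _, Real.exp_pos (2 * Real.log 2 + 2 * S.D), fun t ht => ?_⟩
  have ht0 : 0 < t := (Real.exp_pos _).trans_le ht
  have h := S.exp_le_tsum_term hw.1 ((Real.le_log_iff_exp_le ht0).2 ht)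
  rwa [hwe t ht0, ← S.series_eq ht0] at h

/-- Only the finiteness of ‖If‖ in H_v for the single test function `f` comparable with `w` enters,
so mapping into H_v already forces the condition. -/
theorem IsClunieKovari.limsup_lt_top {w v : RadialWeight} (hw : w.IsClunieKovari)
    {T : w.H → v.H} (hT : ∀ (f : w.H) (z : ℂ), T f z = integrationOperator f z) :
    Filter.limsup (fun r : ℝ => (((1 / v r) * ∫ t in (0 : ℝ)..r, w t : ℝ) : EReal))
      Filter.atTop < ⊤ := by
  obtain ⟨f, g, r₀, A, hg, hfg, hg0, hr₀, hA, hle⟩ := hw.exists_entire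
  set J := ∫ t in (0 : ℝ)..r₀, w t with hJ
  have hJ0 : 0 ≤ J := w.integral_nonneg hr₀.le
  have hv0 := v.pos 0 le_rfl
  refine (Filter.limsup_le_of_le (a := ((J / v 0 + A * ‖T f‖ : ℝ) : EReal)) (by isBoundedDefault)
    ?_).trans_lt (EReal.coe_lt_top _)
  filter_upwards [Filter.eventually_ge_atTop r₀] with r hr
  have hr0 : 0 ≤ r := hr₀.le.trans hr
  have hvr := v.pos r hr0
  rw [EReal.coe_le_coe_iff, one_div, inv_mul_eq_div, div_le_iff₀ hvr]
  have h1 : ∫ t in (0 : ℝ)..r, g t ≤ ‖T f‖ * v r := by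
    have h := v.norm_apply_le (T f) r
    rw [hT, integrationOperator_ofReal hfg, Complex.norm_real, Complex.norm_real,
      Real.norm_eq_abs, Real.norm_eq_abs, abs_of_nonneg hr0] at h
    exact (le_abs_self _).trans h
  have h2 : ∫ t in r₀..r, w t ≤ A * ∫ t in r₀..r, g t := by
    rw [← intervalIntegral.integral_const_mul]
    exact intervalIntegral.integral_mono_on hr (w.intervalIntegrable hr₀.le hr)
      ((hg.intervalIntegrable _ _).const_mul A) fun t ht => hle t ht.1
  have h3 : ∫ t in r₀..r, g t ≤ ∫ t in (0 : ℝ)..r, g t := by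
    rw [← intervalIntegral.integral_add_adjacent_intervals (hg.intervalIntegrable 0 r₀)
      (hg.intervalIntegrable r₀ r)]
    exact le_add_of_nonneg_left (intervalIntegral.integral_nonneg hr₀.le fun t ht => hg0 t ht.1)
  rw [← intervalIntegral.integral_add_adjacent_intervals (w.intervalIntegrable le_rfl hr₀.le)
    (w.intervalIntegrable hr₀.le hr), ← hJ]
  calc J + ∫ t in r₀..r, w t ≤ J / v 0 * v 0 + A * (‖T f‖ * v r) := by
        rw [div_mul_cancel₀ _ hv0.ne']
        exact add_le_add le_rfl (h2.trans (mul_le_mul_of_nonneg_left (h3.trans h1) hA.le))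
    _ ≤ J / v 0 * v r + A * (‖T f‖ * v r) := add_le_add (mul_le_mul_of_nonneg_left
        (v.monotoneOn (Set.mem_Ici.2 le_rfl) hr0 hr0) (div_nonneg hJ0 hv0.le)) le_rfl
    _ = _ := by ring

end RadialWeight

/-- For a Clunie–Kővári weight `w` and any radial weight `v` on `ℂ`, the integration operator is a
continuous linear operator `H_w(ℂ) → H_v(ℂ)` iff `limsup_{r → ∞} (1 / v(r)) ∫₀ʳ w(t) dt < ∞`. -/
theorem mainTheorem9 (w v : RadialWeight) (hw : w.IsClunieKovari) :
    (∃ T : w.H →L[ℂ] v.H, ∀ (f : w.H) (z : ℂ), T f z = integrationOperator f z) ↔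
      Filter.limsup (fun r : ℝ => (((1 / v r) * ∫ t in (0 : ℝ)..r, w t : ℝ) : EReal))
        Filter.atTop < ⊤ := by
  constructor
  · rintro ⟨T, hT⟩
    exact hw.limsup_lt_top hT
  · intro h
    obtain ⟨C, hC⟩ := RadialWeight.exists_bound_of_limsup_lt_top h
    exact RadialWeight.exists_continuousLinearMap hC
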